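/- For real $\nu$ and $y\ge 0$ let $I_\nu(y)=\sum_{k\ge 0}\frac{(y/2)^{2k+\nu}}{k!\,\Gamma(\nu+k+1)}$ be the modified Bessel function of the first kind, let $$Ie_{m,n}(x;a)=\int_0^x y^m e^{-ay} I_n(y)\,dy,\qquad Q_1(\alpha,\beta)=\int_\beta^\infty t\,e^{-(t^2+\alpha^2)/2} I_0(\alpha t)\,dt$$ be the incomplete Lipschitz–Hankel integral and the Marcum $Q$-function, let ${}_2F_1$ be the Gauss hypergeometric function, and let $$\Phi_1(\alpha,\beta,\gamma;u,v)=\sum_{j,k\ge 0}\frac{(\alpha)_{j+k}(\beta)_j}{(\gamma)_{j+k}\,j!\,k!}u^j v^k\qquad(|u|<1)$$ be the Humbert function, where $(\alpha)_k=\alpha(\alpha+1)\cdots(\alpha+k-1)$. Let $a>1$ and $x>0$. For every real $n$ such that $1+2n\notin\{0,-1,-2,\dots\}$, the integral $Ie_{-n,n}(x;a)$ and the double series $\Phi_1$ below converge absolutely, and $$Ie_{-n,n}(x;a)=\frac{{}_2F_1\!\left(n+\tfrac12,1;1+2n;\tfrac{2}{1+a}\right)}{(1+a)\,2^n\,\Gamma(n+1)}-\frac{\Phi_1\!\left(n+\tfrac12,1,1+2n;\tfrac{2}{1+a},2x\right)}{2^n(1+a)\,\Gamma(n+1)\,e^{x(1+a)}}.$$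 In the case $m=n=0$, with $b=\sqrt{x}\sqrt{a+\sqrt{(a+1)(a-1)}}$ and $c=\sqrt{x}\sqrt{a-\sqrt{(a+1)(a-1)}}$, the integrals $Q_1(b,c)$ and $Q_1(c,b)$ converge absolutely and $$Ie_{0,0}(x;a)=\frac{Q_1(b,c)-Q_1(c,b)}{\sqrt{(a+1)(a-1)}}.$$ -/

import Mathlib

open MeasureTheory

noncomputable section

/-- The modified Bessel function of the first kind `I_ν(y)` of real order `ν`, for real `y ≥ 0`:
`I_ν(y) = (y/2)^ν ∑_k (y/2)^(2k) / (k! Γ(ν+k+1))`.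
Since `Real.Gamma` is `0` at its poles and `t / 0 = 0`, the quotient by `Γ` is the multiplication
by the entire function `1/Γ`, as it should be at negative integer orders. -/
def besselI (ν y : ℝ) : ℝ :=
  (y / 2) ^ ν * ∑' k : ℕ, (y / 2) ^ (2 * k) / ((k.factorial : ℝ) * Real.Gamma (ν + k + 1))

/-- The integrand `y^m e^{-ay} I_n(y)` of the incomplete Lipschitz-Hankel integral. -/
def lipschitzHankelIntegrand (m n a y : ℝ) : ℝ :=
  y ^ m * Real.exp (-(a * y)) * besselI n y

/-- The incomplete Lipschitz-Hankel integral
`Ie_{m,n}(x;a) = ∫_0^x y^m e^{-ay} I_n(y) dy`. -/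
def lipschitzHankelIe (m n x a : ℝ) : ℝ :=
  ∫ y in (0 : ℝ)..x, lipschitzHankelIntegrand m n a y

/-- The integrand `t e^{-(t²+α²)/2} I_0(αt)` of the Marcum function. -/
def marcumQIntegrand (α t : ℝ) : ℝ :=
  t * Real.exp (-((t ^ 2 + α ^ 2) / 2)) * besselI 0 (α * t)

/-- The (first order) Marcum function
`Q_1(α,β) = ∫_β^∞ t e^{-(t²+α²)/2} I_0(αt) dt`. -/
def marcumQ (α β : ℝ) : ℝ :=
  ∫ t in Set.Ioi β, marcumQIntegrand α t

/-- The term of index `(j,k)` of the Humbert double series: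
`(α)_{j+k} (β)_j / ((γ)_{j+k} j! k!) u^j v^k`, with rising factorials. -/
def humbertPhi1Term (α β γ u v : ℝ) (p : ℕ × ℕ) : ℝ :=
  (ascPochhammer ℝ (p.1 + p.2)).eval α * (ascPochhammer ℝ p.1).eval β /
      ((ascPochhammer ℝ (p.1 + p.2)).eval γ * (p.1.factorial : ℝ) * (p.2.factorial : ℝ)) *
    u ^ p.1 * v ^ p.2

/-- The Humbert function (confluent Appell function) `Φ₁(α, β, γ; u, v)`, for `|u| < 1` and `γ`
not in `{0, -1, -2, …}`. -/
def humbertPhi1 (α β γ u v : ℝ) : ℝ :=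
  ∑' p : ℕ × ℕ, humbertPhi1Term α β γ u v p

end

open Filter Topology Set

/-! Both formulas come from integrating power series term by term. With `e_m` the truncated
exponential `expSum m`, the function `-e^{-z} e_m(z)` is a primitive of `e^{-z} z^m / m!`.

General `n`: Kummer's second transformation `e^y ₀F₁(; n+1; y²/4) = ₁F₁(n+1/2; 1+2n; 2y)` turns
`y^{-n} e^{-ay} I_n(y)` into a constant times `e^{-sy} ₁F₁`, with `s = 1 + a`. The `m`-th term
integrates to a multiple of `(2/s)^m (1 - e^{-sx} e_m(sx))`: the `1` sums to `₂F₁`, and the `e_m`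
part is `Φ₁` grouped by `j + k = m` (`lipschitzHankelIe_neg_eq`).

Case `m = n = 0`: `Q₁(α,β) = e^{-(α²+β²)/2} ∑ (α²/2)^k/k! e_k(β²/2)` (`marcumQ_eq_tsum`). Put `P =
b²/(2x)` and `Q = c²/(2x)`, so that `P + Q = a` and `PQ = 1/4`. As a function of `x`, `Q₁(b,c) -
Q₁(c,b)` vanishes at `0` and has derivative `(P - Q) e^{-ax} I_0(x)`
(`hasDerivAt_exp_neg_mul_marcumSeries_sub`), where `P - Q = √(a² - 1)`. -/

/-! ### Truncated exponentials -/

/-- The Taylor polynomial of degree `m` of the exponential function. -/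
noncomputable def expSum (m : ℕ) (z : ℝ) : ℝ := ∑ j ∈ Finset.range (m + 1), z ^ j / (j.factorial : ℝ)

theorem expSum_succ (m : ℕ) (z : ℝ) :
    expSum (m + 1) z = expSum m z + z ^ (m + 1) / ((m + 1).factorial : ℝ) := by
  rw [expSum, Finset.sum_range_succ, ← expSum]

@[simp] theorem expSum_zero_right (m : ℕ) : expSum m 0 = 1 := by
  rw [expSum, Finset.sum_range_succ']
  simp

theorem abs_expSum_le (m : ℕ) (z : ℝ) : |expSum m z| ≤ Real.exp |z| := by
  refine le_trans ?_ (Real.sum_le_exp_of_nonneg (abs_nonneg z) (m + 1))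
  refine (Finset.abs_sum_le_sum_abs _ _).trans_eq (Finset.sum_congr rfl fun j _ => ?_)
  rw [abs_div, abs_pow, Nat.abs_cast]

theorem hasDerivAt_pow_div_factorial (m : ℕ) (z : ℝ) :
    HasDerivAt (fun z : ℝ => z ^ (m + 1) / ((m + 1).factorial : ℝ))
      (z ^ m / (m.factorial : ℝ)) z := by
  refine ((hasDerivAt_pow (m + 1) z).div_const _).congr_deriv ?_
  rw [Nat.factorial_succ]
  push_cast
  have : (m.factorial : ℝ) ≠ 0 := by positivity
  field_simp

theorem hasDerivAt_expSum (m : ℕ) (z : ℝ) :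
    HasDerivAt (expSum m) (expSum m z - z ^ m / (m.factorial : ℝ)) z := by
  induction m with
  | zero =>
    have : expSum 0 = fun _ => (1 : ℝ) := by ext; simp [expSum]
    rw [this]
    simpa using hasDerivAt_const z (1 : ℝ)
  | succ m ih =>
    have h : expSum (m + 1) = fun z => expSum m z + z ^ (m + 1) / ((m + 1).factorial : ℝ) :=
      funext (expSum_succ m)
    rw [h]
    refine (ih.add (hasDerivAt_pow_div_factorial m z)).congr_deriv ?_
    ring

/-- In the product rule everything cancels except the top-degree term of the polynomial. -/
theorem hasDerivAt_exp_neg_mul_expSum (m : ℕ) (z : ℝ) :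
    HasDerivAt (fun z => Real.exp (-z) * expSum m z)
      (-(Real.exp (-z) * (z ^ m / (m.factorial : ℝ)))) z := by
  refine ((hasDerivAt_neg z).exp.mul (hasDerivAt_expSum m z)).congr_deriv ?_
  ring

theorem tendsto_exp_neg_mul_expSum (m : ℕ) :
    Tendsto (fun z => Real.exp (-z) * expSum m z) atTop (𝓝 0) := by
  have : (fun z => Real.exp (-z) * expSum m z) = fun z =>
      ∑ j ∈ Finset.range (m + 1), z ^ j * Real.exp (-z) / (j.factorial : ℝ) := by
    ext z
    rw [expSum, Finset.mul_sum]
    exact Finset.sum_congr rfl fun j _ => by ring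
  rw [this, ← Finset.sum_const_zero (s := Finset.range (m + 1))]
  refine tendsto_finsetSum _ fun j _ => ?_
  simpa using (Real.tendsto_pow_mul_exp_neg_atTop_nhds_zero j).div_const (j.factorial : ℝ)

/-! ### Series for the Marcum function -/

theorem hasSum_besselI_zero (y : ℝ) :
    HasSum (fun k : ℕ => (y / 2) ^ (2 * k) / ((k.factorial : ℝ) * k.factorial))
      (besselI 0 y) := by
  have h : besselI 0 y =
      ∑' k : ℕ, (y / 2) ^ (2 * k) / ((k.factorial : ℝ) * k.factorial) := by
    simp [besselI, Real.Gamma_nat_eq_factorial]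
  rw [h]
  refine Summable.hasSum (.of_nonneg_of_le (fun k => ?_) (fun k => ?_)
    (Real.summable_pow_div_factorial ((y / 2) ^ 2)))
  · rw [pow_mul]; positivity
  · rw [pow_mul]
    refine div_le_div_of_nonneg_left (by positivity) (by positivity) ?_
    have : (1 : ℝ) ≤ k.factorial := by exact_mod_cast Nat.factorial_pos k
    nlinarith

/-- A sum of nonnegative integrable functions with summable integrals is integrable. -/
theorem integrable_of_hasSum_of_nonneg {α : Type*} {m : MeasurableSpace α} {μ : Measure α}
    {F : ℕ → α → ℝ} {f : α → ℝ} (hF : ∀ i, Integrable (F i) μ)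
    (hpos : ∀ i, ∀ᵐ t ∂μ, 0 ≤ F i t) (hs : Summable fun i => ∫ t, F i t ∂μ)
    (hf : ∀ᵐ t ∂μ, HasSum (fun i => F i t) (f t)) : Integrable f μ := by
  have hmeas : AEStronglyMeasurable f μ := by
    refine aestronglyMeasurable_of_tendsto_ae atTop
      (f := fun n t => ∑ i ∈ Finset.range n, F i t) (fun n => ?_) ?_
    · exact (integrable_finsetSum _ fun i _ => hF i).aestronglyMeasurable
    · filter_upwards [hf] with t ht using ht.tendsto_sum_nat
  refine ⟨hmeas, ?_⟩
  have hpos' := ae_all_iff.2 hpos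
  rw [hasFiniteIntegral_iff_ofReal (by
    filter_upwards [hf, hpos'] with t ht hp using ht.nonneg hp)]
  -- Tonelli: nonnegative terms allow the sum and the integral to be exchanged without prior
  -- integrability.
  have : ∫⁻ t, ENNReal.ofReal (f t) ∂μ = ∑' i, ENNReal.ofReal (∫ t, F i t ∂μ) := by
    simp_rw [fun i => ofReal_integral_eq_lintegral_ofReal (hF i) (hpos i)]
    rw [← lintegral_tsum fun i => (hF i).aestronglyMeasurable.aemeasurable.ennreal_ofReal]
    refine lintegral_congr_ae ?_
    filter_upwards [hf, hpos'] with t ht hp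
    rw [← ht.tsum_eq, ENNReal.ofReal_tsum_of_nonneg hp ht.summable]
  rw [this, ← ENNReal.ofReal_tsum_of_nonneg (fun i => integral_nonneg_of_ae (hpos i)) hs]
  exact ENNReal.ofReal_lt_top

/-- The `k`-th term of the expansion of the Marcum integrand. -/
noncomputable def marcumTerm (α t : ℝ) (k : ℕ) : ℝ :=
  Real.exp (-(α ^ 2 / 2)) * ((α ^ 2 / 2) ^ k / (k.factorial : ℝ)) *
    (t * (Real.exp (-(t ^ 2 / 2)) * ((t ^ 2 / 2) ^ k / (k.factorial : ℝ))))

theorem hasSum_marcumTerm (α t : ℝ) : HasSum (marcumTerm α t) (marcumQIntegrand α t) := by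
  refine ((hasSum_besselI_zero (α * t)).mul_left
    (t * Real.exp (-((t ^ 2 + α ^ 2) / 2)))).congr_fun fun k => ?_
  have h : -((t ^ 2 + α ^ 2) / 2) = -(α ^ 2 / 2) + -(t ^ 2 / 2) := by ring
  have h2 : (α * t / 2) ^ (2 * k) = (α ^ 2 / 2) ^ k * (t ^ 2 / 2) ^ k := by
    rw [pow_mul, ← mul_pow]; congr 1; ring
  rw [marcumTerm, h, Real.exp_add, h2]
  field_simp

theorem marcumTerm_nonneg (α : ℝ) {t : ℝ} (ht : 0 ≤ t) (k : ℕ) : 0 ≤ marcumTerm α t k := by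
  rw [marcumTerm]; positivity

/-- Substituting `z = t²/2` absorbs the factor `t` of the integrand. -/
theorem hasDerivAt_marcumTerm_primitive (α t : ℝ) (k : ℕ) :
    HasDerivAt (fun t => -(Real.exp (-(α ^ 2 / 2)) * ((α ^ 2 / 2) ^ k / (k.factorial : ℝ)) *
      (Real.exp (-(t ^ 2 / 2)) * expSum k (t ^ 2 / 2)))) (marcumTerm α t k) t := by
  have h1 : HasDerivAt (fun t : ℝ => t ^ 2 / 2) t t :=
    ((hasDerivAt_pow 2 t).div_const 2).congr_deriv (by simp)
  have h2 := (hasDerivAt_exp_neg_mul_expSum k (t ^ 2 / 2)).comp t h1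
  refine ((h2.const_mul
    (Real.exp (-(α ^ 2 / 2)) * ((α ^ 2 / 2) ^ k / (k.factorial : ℝ)))).neg).congr_deriv ?_
  rw [marcumTerm]
  ring

theorem tendsto_marcumTerm_primitive (α : ℝ) (k : ℕ) :
    Tendsto (fun t => -(Real.exp (-(α ^ 2 / 2)) * ((α ^ 2 / 2) ^ k / (k.factorial : ℝ)) *
      (Real.exp (-(t ^ 2 / 2)) * expSum k (t ^ 2 / 2)))) atTop (𝓝 0) := by
  have h1 : Tendsto (fun t : ℝ => t ^ 2 / 2) atTop atTop :=
    (tendsto_pow_atTop two_ne_zero).atTop_div_const two_pos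
  have h2 := (((tendsto_exp_neg_mul_expSum k).comp h1).const_mul
    (Real.exp (-(α ^ 2 / 2)) * ((α ^ 2 / 2) ^ k / (k.factorial : ℝ)))).neg
  rwa [mul_zero, neg_zero] at h2

theorem integrableOn_marcumTerm (α : ℝ) {β : ℝ} (hβ : 0 ≤ β) (k : ℕ) :
    IntegrableOn (fun t => marcumTerm α t k) (Ioi β) :=
  integrableOn_Ioi_deriv_of_nonneg' (fun t _ => hasDerivAt_marcumTerm_primitive α t k)
    (fun _ ht => marcumTerm_nonneg α (hβ.trans (le_of_lt ht)) k)
    (tendsto_marcumTerm_primitive α k)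

theorem integral_marcumTerm (α : ℝ) {β : ℝ} (hβ : 0 ≤ β) (k : ℕ) :
    ∫ t in Ioi β, marcumTerm α t k =
      Real.exp (-(α ^ 2 / 2 + β ^ 2 / 2)) *
        ((α ^ 2 / 2) ^ k / (k.factorial : ℝ) * expSum k (β ^ 2 / 2)) := by
  rw [integral_Ioi_of_hasDerivAt_of_nonneg' (fun t _ => hasDerivAt_marcumTerm_primitive α t k)
    (fun _ ht => marcumTerm_nonneg α (hβ.trans (le_of_lt ht)) k)
    (tendsto_marcumTerm_primitive α k), neg_add, Real.exp_add]
  ring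

theorem abs_pow_div_factorial_mul_expSum_le {p q R S : ℝ} (hp : |p| ≤ R) (hq : |q| ≤ S)
    (k l : ℕ) :
    |p ^ k / (k.factorial : ℝ) * expSum l q| ≤ R ^ k / (k.factorial : ℝ) * Real.exp S := by
  rw [abs_mul, abs_div, abs_pow, Nat.abs_cast]
  have h := (abs_expSum_le l q).trans (Real.exp_le_exp.2 hq)
  have : 0 ≤ R := (abs_nonneg p).trans hp
  gcongr

theorem summable_pow_div_factorial_mul_expSum (p q : ℝ) :
    Summable fun k : ℕ => p ^ k / (k.factorial : ℝ) * expSum k q :=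
  .of_norm_bounded ((Real.summable_pow_div_factorial |p|).mul_right (Real.exp |q|))
    fun k => abs_pow_div_factorial_mul_expSum_le le_rfl le_rfl k k

theorem summable_integral_marcumTerm (α : ℝ) {β : ℝ} (hβ : 0 ≤ β) :
    Summable fun k => ∫ t in Ioi β, marcumTerm α t k := by
  simp_rw [integral_marcumTerm α hβ]
  exact (summable_pow_div_factorial_mul_expSum _ _).mul_left _

theorem integrableOn_marcumQIntegrand (α : ℝ) {β : ℝ} (hβ : 0 ≤ β) :
    IntegrableOn (marcumQIntegrand α) (Ioi β) :=
  integrable_of_hasSum_of_nonneg (fun k => integrableOn_marcumTerm α hβ k)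
    (fun k => (ae_restrict_mem measurableSet_Ioi).mono fun _ ht =>
      marcumTerm_nonneg α (hβ.trans (le_of_lt ht)) k)
    (summable_integral_marcumTerm α hβ) (ae_of_all _ fun t => hasSum_marcumTerm α t)

theorem marcumQ_eq_tsum (α : ℝ) {β : ℝ} (hβ : 0 ≤ β) :
    marcumQ α β = Real.exp (-(α ^ 2 / 2 + β ^ 2 / 2)) *
      ∑' k : ℕ, (α ^ 2 / 2) ^ k / (k.factorial : ℝ) * expSum k (β ^ 2 / 2) := by
  have h1 : marcumQ α β = ∫ t in Ioi β, ∑' k, marcumTerm α t k := by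
    simp_rw [fun t => (hasSum_marcumTerm α t).tsum_eq]
    rfl
  have h2 : ∀ k, ∫ t in Ioi β, ‖marcumTerm α t k‖ = ∫ t in Ioi β, marcumTerm α t k := fun k =>
    setIntegral_congr_fun measurableSet_Ioi fun t ht =>
      Real.norm_of_nonneg (marcumTerm_nonneg α (hβ.trans (le_of_lt ht)) k)
  rw [h1, ← integral_tsum_of_summable_integral_norm
    (fun k => integrableOn_marcumTerm α hβ k)
    (by simp_rw [h2]; exact summable_integral_marcumTerm α hβ), ← tsum_mul_left]
  exact tsum_congr fun k => integral_marcumTerm α hβ k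

/-! ### Differentiating the Marcum series; the case m = n = 0 -/

/-- The generating series `∑ₖ (Px)ᵏ/k! ∑_{j ≤ k} (Qx)ʲ/j!`. -/
noncomputable def marcumSeries (P Q x : ℝ) : ℝ :=
  ∑' k : ℕ, (P * x) ^ k / (k.factorial : ℝ) * expSum k (Q * x)

theorem marcumSeries_zero (P Q : ℝ) : marcumSeries P Q 0 = 1 := by
  rw [marcumSeries, tsum_eq_single 0]
  · simp
  · intro k hk
    simp [hk]

/-- The derivative of the `k`-th term of `marcumSeries`. -/
noncomputable def marcumSeriesDerivTerm (P Q x : ℝ) : ℕ → ℝ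
  | 0 => 0
  | k + 1 => P * ((P * x) ^ k / (k.factorial : ℝ) * expSum (k + 1) (Q * x)) +
      Q * ((P * x) ^ (k + 1) / ((k + 1).factorial : ℝ) * expSum k (Q * x))

theorem hasDerivAt_marcumSeries_term (P Q x : ℝ) (k : ℕ) :
    HasDerivAt (fun x => (P * x) ^ k / (k.factorial : ℝ) * expSum k (Q * x))
      (marcumSeriesDerivTerm P Q x k) x := by
  have hl : ∀ c : ℝ, HasDerivAt (fun x => c * x) c x := fun c => by
    simpa using (hasDerivAt_id x).const_mul c
  cases k with
  | zero =>
    simpa [expSum, marcumSeriesDerivTerm] using hasDerivAt_const x (1 : ℝ)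
  | succ k =>
    have h1 := (hasDerivAt_pow_div_factorial k (P * x)).comp x (hl P)
    have h2 := (hasDerivAt_expSum (k + 1) (Q * x)).comp x (hl Q)
    refine (h1.mul h2).congr_deriv ?_
    simp only [Function.comp, marcumSeriesDerivTerm, expSum_succ k]
    ring

theorem summable_pow_div_factorial_mul_shift (p q : ℝ) (l : ℕ) :
    Summable fun k : ℕ => p ^ k / (k.factorial : ℝ) * (q ^ (k + l) / ((k + l).factorial : ℝ)) := by
  have h := ((Real.summable_pow_div_factorial |p|).mul_of_nonneg
    (Real.summable_pow_div_factorial |q|) (fun k => by positivity)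
    (fun k => by positivity)).comp_injective
    (i := fun k : ℕ => (k, k + l)) fun a b h => (Prod.mk.inj h).1
  refine .of_norm_bounded h fun k => le_of_eq ?_
  simp

/-- Differentiating the power of `Px` lowers `k`, so its truncation is one term too long;
differentiating the truncation makes it one term too short. The two corrections are the off-diagonal
and diagonal sums. -/
theorem hasDerivAt_marcumSeries (P Q x : ℝ) :
    HasDerivAt (marcumSeries P Q)
      ((P + Q) * marcumSeries P Q x +
        P * (∑' k : ℕ, (P * x) ^ k / (k.factorial : ℝ) *
          ((Q * x) ^ (k + 1) / ((k + 1).factorial : ℝ))) -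
        Q * ∑' k : ℕ, (P * x) ^ k / (k.factorial : ℝ) * ((Q * x) ^ k / (k.factorial : ℝ))) x := by
  set R := |x| + 1 with hR
  have hxR : x ∈ Ioo (-R) R := by
    rw [mem_Ioo, ← abs_lt]; linarith
  -- Majorant of the differentiated terms, uniform on `|y| < R`.
  set u : ℕ → ℝ := fun k => Nat.casesOn k 0 fun k =>
    |P| * ((|P| * R) ^ k / (k.factorial : ℝ) * Real.exp (|Q| * R)) +
    |Q| * ((|P| * R) ^ (k + 1) / ((k + 1).factorial : ℝ) * Real.exp (|Q| * R)) with hu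
  have hsum := Real.summable_pow_div_factorial (|P| * R)
  have hus : Summable u := by
    rw [← summable_nat_add_iff 1]
    exact ((hsum.mul_right _).mul_left _).add
      ((((summable_nat_add_iff 1).2 hsum).mul_right _).mul_left _)
  have hbound : ∀ k, ∀ y ∈ Ioo (-R) R, ‖marcumSeriesDerivTerm P Q y k‖ ≤ u k := by
    intro k y hy
    have hy' : |y| ≤ R := (abs_lt.2 hy).le
    have hp : |P * y| ≤ |P| * R := by rw [abs_mul]; gcongr
    have hq : |Q * y| ≤ |Q| * R := by rw [abs_mul]; gcongr
    cases k with
    | zero => simp [marcumSeriesDerivTerm, hu]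
    | succ k =>
      refine (abs_add_le _ _).trans (add_le_add ?_ ?_)
      · rw [abs_mul]
        exact mul_le_mul_of_nonneg_left
          (abs_pow_div_factorial_mul_expSum_le hp hq _ _) (abs_nonneg _)
      · rw [abs_mul]
        exact mul_le_mul_of_nonneg_left
          (abs_pow_div_factorial_mul_expSum_le hp hq _ _) (abs_nonneg _)
  have hderiv := hasDerivAt_tsum_of_isPreconnected hus isOpen_Ioo isPreconnected_Ioo
    (fun k y _ => hasDerivAt_marcumSeries_term P Q y k) hbound hxR
    (summable_pow_div_factorial_mul_expSum (P * x) (Q * x)) hxR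
  refine hderiv.congr_deriv ?_
  have hT : Summable (marcumSeriesDerivTerm P Q x) :=
    .of_norm_bounded hus fun k => hbound k x hxR
  have hS := summable_pow_div_factorial_mul_expSum (P * x) (Q * x)
  have hC := summable_pow_div_factorial_mul_shift (P * x) (Q * x) 1
  have hD : Summable fun k : ℕ => (P * x) ^ k / (k.factorial : ℝ) *
      ((Q * x) ^ k / (k.factorial : ℝ)) :=
    summable_pow_div_factorial_mul_shift (P * x) (Q * x) 0
  have hf := hS.sub hD
  have e : ∀ k, marcumSeriesDerivTerm P Q x (k + 1) =
      P * ((P * x) ^ k / (k.factorial : ℝ) * expSum k (Q * x)) +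
      P * ((P * x) ^ k / (k.factorial : ℝ) * ((Q * x) ^ (k + 1) / ((k + 1).factorial : ℝ))) +
      Q * ((P * x) ^ (k + 1) / ((k + 1).factorial : ℝ) * expSum (k + 1) (Q * x) -
        (P * x) ^ (k + 1) / ((k + 1).factorial : ℝ) *
          ((Q * x) ^ (k + 1) / ((k + 1).factorial : ℝ))) := fun k => by
    rw [marcumSeriesDerivTerm, expSum_succ k]
    ring
  -- Series minus diagonal has zero term at `k = 0`, so the index shift costs nothing.
  have hshift := hf.tsum_eq_zero_add
  have hsub := hS.tsum_sub hD
  rw [hT.tsum_eq_zero_add, tsum_congr e, Summable.tsum_add ((hS.mul_left P).add (hC.mul_left P))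
    (((summable_nat_add_iff 1).2 hf).mul_left Q), Summable.tsum_add (hS.mul_left P) (hC.mul_left P),
    tsum_mul_left, tsum_mul_left, tsum_mul_left]
  rw [hsub] at hshift
  have h0 : (P * x) ^ 0 / ((0 : ℕ).factorial : ℝ) * expSum 0 (Q * x) -
      (P * x) ^ 0 / ((0 : ℕ).factorial : ℝ) * ((Q * x) ^ 0 / ((0 : ℕ).factorial : ℝ)) = 0 := by
    simp [expSum]
  rw [h0] at hshift
  simp only [marcumSeriesDerivTerm, marcumSeries]
  linear_combination -Q * hshift

theorem hasDerivAt_exp_neg_mul_marcumSeries_sub (P Q x : ℝ) (hPQ : P * Q = 1 / 4) :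
    HasDerivAt (fun x => Real.exp (-((P + Q) * x)) * (marcumSeries P Q x - marcumSeries Q P x))
      ((P - Q) * (Real.exp (-((P + Q) * x)) * besselI 0 x)) x := by
  have hI : ∀ p q : ℝ, p * q = 1 / 4 → ∑' k : ℕ, (p * x) ^ k / (k.factorial : ℝ) *
      ((q * x) ^ k / (k.factorial : ℝ)) = besselI 0 x := by
    intro p q hpq
    rw [← (hasSum_besselI_zero x).tsum_eq]
    refine tsum_congr fun k => ?_
    rw [pow_mul, div_mul_div_comm, ← mul_pow]
    congr 2
    linear_combination x ^ 2 * hpq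
  -- The coefficients are `(PQ)^(k+1)` on both sides; the off-diagonal sums therefore cancel in the
  -- difference.
  have hcross : P * (∑' k : ℕ, (P * x) ^ k / (k.factorial : ℝ) *
          ((Q * x) ^ (k + 1) / ((k + 1).factorial : ℝ))) =
      Q * (∑' k : ℕ, (Q * x) ^ k / (k.factorial : ℝ) *
          ((P * x) ^ (k + 1) / ((k + 1).factorial : ℝ))) := by
    rw [← tsum_mul_left, ← tsum_mul_left]
    refine tsum_congr fun k => ?_
    rw [mul_pow, mul_pow, mul_pow, mul_pow]
    ring
  have h1 := hasDerivAt_marcumSeries P Q x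
  have h2 := hasDerivAt_marcumSeries Q P x
  rw [hI P Q hPQ] at h1
  rw [hI Q P (by rw [mul_comm, hPQ]), ← hcross] at h2
  have h3 : HasDerivAt (fun x => -((P + Q) * x)) (-(P + Q)) x := by
    refine ((hasDerivAt_id x).const_mul (-(P + Q))).congr_deriv (mul_one _) |>.congr_of_eventuallyEq
      (.of_forall fun y => ?_)
    simp only [id, neg_mul]
  refine (h3.exp.mul (h1.sub h2)).congr_deriv ?_
  rw [Pi.sub_apply]
  ring

theorem continuous_tsum_mul_pow {c : ℕ → ℝ} (h : ∀ r : ℝ, 0 ≤ r → Summable fun k => |c k| * r ^ k) :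
    Continuous fun y : ℝ => ∑' k, c k * y ^ k := by
  refine continuous_iff_continuousAt.2 fun y => ?_
  have hy : y ∈ Metric.ball (0 : ℝ) (|y| + 1) := by simp
  refine (continuousOn_tsum (s := Metric.ball (0 : ℝ) (|y| + 1)) (fun k => by fun_prop)
    (h (|y| + 1) (by positivity)) fun k z hz => ?_).continuousAt (Metric.isOpen_ball.mem_nhds hy)
  rw [mem_ball_zero_iff, Real.norm_eq_abs] at hz
  rw [norm_mul, norm_pow, Real.norm_eq_abs, Real.norm_eq_abs]
  gcongr

theorem continuous_besselI_zero : Continuous (besselI 0) := by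
  have h : Continuous fun y : ℝ => ∑' k : ℕ, 1 / ((k.factorial : ℝ) * k.factorial) * y ^ k := by
    refine continuous_tsum_mul_pow fun r hr => ?_
    -- At argument `2√r` the Bessel series has powers `r^k`.
    refine (hasSum_besselI_zero (2 * √r)).summable.congr fun k => ?_
    rw [mul_div_cancel_left₀ _ two_ne_zero, pow_mul, Real.sq_sqrt hr, abs_of_nonneg (by positivity)]
    ring
  have e : besselI 0 = (fun y : ℝ => ∑' k : ℕ, 1 / ((k.factorial : ℝ) * k.factorial) * y ^ k) ∘
      fun y => (y / 2) ^ 2 := by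
    ext y
    rw [← (hasSum_besselI_zero y).tsum_eq]
    refine tsum_congr fun k => ?_
    rw [pow_mul]
    ring
  rw [e]
  exact h.comp (by fun_prop)

theorem integral_exp_neg_mul_besselI_zero (P Q x : ℝ) (hPQ : P * Q = 1 / 4) :
    (P - Q) * ∫ y in (0 : ℝ)..x, Real.exp (-((P + Q) * y)) * besselI 0 y =
      Real.exp (-((P + Q) * x)) * (marcumSeries P Q x - marcumSeries Q P x) := by
  have hc : Continuous fun y => (P - Q) * (Real.exp (-((P + Q) * y)) * besselI 0 y) := by
    have := continuous_besselI_zero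
    fun_prop
  rw [← intervalIntegral.integral_const_mul, intervalIntegral.integral_eq_sub_of_hasDerivAt
    (fun y _ => hasDerivAt_exp_neg_mul_marcumSeries_sub P Q y hPQ) (hc.intervalIntegrable _ _)]
  simp [marcumSeries_zero]

theorem lipschitzHankelIe_zero_zero (a x b c : ℝ) (ha : 1 < a) (hx : 0 < x)
    (hb : b = √x * √(a + √((a + 1) * (a - 1)))) (hc : c = √x * √(a - √((a + 1) * (a - 1)))) :
    IntegrableOn (marcumQIntegrand b) (Ioi c) ∧ IntegrableOn (marcumQIntegrand c) (Ioi b) ∧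
      lipschitzHankelIe 0 0 x a = (marcumQ b c - marcumQ c b) / √((a + 1) * (a - 1)) := by
  have hb0 : 0 ≤ b := by rw [hb]; positivity
  have hc0 : 0 ≤ c := by rw [hc]; positivity
  refine ⟨integrableOn_marcumQIntegrand b hc0, integrableOn_marcumQIntegrand c hb0, ?_⟩
  have hpos : 0 < (a + 1) * (a - 1) := mul_pos (by linarith) (by linarith)
  set r := √((a + 1) * (a - 1)) with hr
  have hr0 : 0 < r := Real.sqrt_pos.2 hpos
  have hr2 : r ^ 2 = a ^ 2 - 1 := by rw [hr, Real.sq_sqrt hpos.le]; ring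
  -- Makes the radicand `a - r` nonnegative, so that `c²` is the intended value.
  have hra : r ≤ a := by nlinarith
  have hb2 : b ^ 2 / 2 = (a + r) / 2 * x := by
    rw [hb, mul_pow, Real.sq_sqrt hx.le, Real.sq_sqrt (by linarith)]; ring
  have hc2 : c ^ 2 / 2 = (a - r) / 2 * x := by
    rw [hc, mul_pow, Real.sq_sqrt hx.le, Real.sq_sqrt (by linarith)]; ring
  have key := integral_exp_neg_mul_besselI_zero ((a + r) / 2) ((a - r) / 2) x
    (by linear_combination -hr2 / 4)
  have e1 : (a + r) / 2 + (a - r) / 2 = a := by ring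
  have e2 : (a + r) / 2 - (a - r) / 2 = r := by ring
  rw [e1, e2] at key
  have hI : lipschitzHankelIe 0 0 x a =
      ∫ y in (0 : ℝ)..x, Real.exp (-(a * y)) * besselI 0 y := by
    simp [lipschitzHankelIe, lipschitzHankelIntegrand]
  have e3 : (a + r) / 2 * x + (a - r) / 2 * x = a * x := by ring
  have e4 : (a - r) / 2 * x + (a + r) / 2 * x = a * x := by ring
  rw [eq_div_iff hr0.ne', mul_comm, hI, key, marcumQ_eq_tsum b hc0, marcumQ_eq_tsum c hb0, hb2, hc2,
    e3, e4, ← mul_sub]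
  rfl

/-! ### Growth of the hypergeometric coefficients -/

/-- The quotient `(n + 1/2)ₘ / (1 + 2n)ₘ` of rising factorials. -/
noncomputable def pochhammerRatio (n : ℝ) (m : ℕ) : ℝ :=
  (ascPochhammer ℝ m).eval (n + 1 / 2) / (ascPochhammer ℝ m).eval (1 + 2 * n)

theorem ascPochhammer_eval_ne_zero {z : ℝ} (hz : ∀ k : ℕ, z ≠ -(k : ℝ)) (m : ℕ) :
    (ascPochhammer ℝ m).eval z ≠ 0 := by
  rw [Ne, ascPochhammer_eval_eq_zero_iff]
  rintro ⟨k, -, hk⟩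
  exact hz k (by rw [hk, neg_neg])

theorem add_natCast_ne_zero {z : ℝ} (hz : ∀ k : ℕ, z ≠ -(k : ℝ)) (m : ℕ) : z + m ≠ 0 :=
  fun h => hz m (by linarith)

/-- Excluding even `k` in `1 + 2n = -k` protects `n + 1/2`; excluding odd `k` protects `n + 1`,
hence `Γ(n+1)`. -/
theorem add_half_ne_neg_natCast {n : ℝ} (hn : ∀ k : ℕ, 1 + 2 * n ≠ -(k : ℝ)) (k : ℕ) :
    n + 1 / 2 ≠ -(k : ℝ) :=
  fun h => hn (2 * k) (by push_cast; linarith)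

theorem add_one_ne_neg_natCast {n : ℝ} (hn : ∀ k : ℕ, 1 + 2 * n ≠ -(k : ℝ)) (k : ℕ) :
    n + 1 ≠ -(k : ℝ) :=
  fun h => hn (2 * k + 1) (by push_cast; linarith)

theorem pochhammerRatio_succ {n : ℝ} (hn : ∀ k : ℕ, 1 + 2 * n ≠ -(k : ℝ)) (m : ℕ) :
    pochhammerRatio n (m + 1) * (1 + 2 * n + m) = pochhammerRatio n m * (n + 1 / 2 + m) := by
  have h1 := ascPochhammer_eval_ne_zero hn m
  have h2 := add_natCast_ne_zero hn m
  rw [pochhammerRatio, pochhammerRatio, ascPochhammer_succ_eval, ascPochhammer_succ_eval]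
  generalize (ascPochhammer ℝ m).eval (1 + 2 * n) = A at *
  generalize 1 + 2 * n + (m : ℝ) = B at *
  field_simp

theorem ordinaryHypergeometricCoefficient_one_eq (n : ℝ) (m : ℕ) :
    ordinaryHypergeometricCoefficient (n + 1 / 2) 1 (1 + 2 * n) m = pochhammerRatio n m := by
  have h : (m.factorial : ℝ) ≠ 0 := by positivity
  rw [ordinaryHypergeometricCoefficient, ascPochhammer_eval_one, pochhammerRatio]
  field_simp

theorem ordinaryHypergeometric_one_eq_tsum (n u : ℝ) :
    ordinaryHypergeometric (n + 1 / 2) 1 (1 + 2 * n) u = ∑' m, pochhammerRatio n m * u ^ m := by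
  rw [ordinaryHypergeometric, ordinaryHypergeometric_sum_eq]
  exact tsum_congr fun m => by rw [smul_eq_mul, ← ordinaryHypergeometricCoefficient_one_eq]

/-- No parameter is a nonpositive integer, so the `₂F₁` series has radius of convergence exactly 1.
-/
theorem summable_abs_pochhammerRatio_mul_pow {n : ℝ} (hn : ∀ k : ℕ, 1 + 2 * n ≠ -(k : ℝ)) {r : ℝ}
    (hr0 : 0 ≤ r) (hr : r < 1) : Summable fun m => |pochhammerRatio n m| * r ^ m := by
  have hrad := ordinaryHypergeometricSeries_radius_eq_one (𝕂 := ℝ) ℝ (n + 1 / 2) 1 (1 + 2 * n)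
    fun k => ⟨fun h => add_half_ne_neg_natCast hn k (by linarith), fun h => by
      have : (0 : ℝ) ≤ k := k.cast_nonneg
      linarith, fun h => hn k (by linarith)⟩
  have h := (ordinaryHypergeometricSeries ℝ (n + 1 / 2) 1 (1 + 2 * n)).summable_norm_apply
    (x := r) (by
      rw [hrad, mem_eball_zero_iff, Real.enorm_eq_ofReal hr0]
      exact ENNReal.ofReal_lt_one.2 hr)
  refine h.congr fun m => ?_
  rw [ordinaryHypergeometricSeries_apply_eq, ← ordinaryHypergeometricCoefficient,
    ordinaryHypergeometricCoefficient_one_eq, norm_smul, norm_pow, Real.norm_eq_abs,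
    Real.norm_of_nonneg hr0]

/-- A term of the convergent series at `1/ρ` is at most its sum. -/
theorem exists_abs_pochhammerRatio_le {n : ℝ} (hn : ∀ k : ℕ, 1 + 2 * n ≠ -(k : ℝ)) {ρ : ℝ}
    (hρ : 1 < ρ) : ∃ C, 0 ≤ C ∧ ∀ m, |pochhammerRatio n m| ≤ C * ρ ^ m := by
  have h0 : 0 < ρ := by linarith
  have h := summable_abs_pochhammerRatio_mul_pow hn (inv_nonneg.2 h0.le) (inv_lt_one_of_one_lt₀ hρ)
  refine ⟨∑' m, |pochhammerRatio n m| * ρ⁻¹ ^ m, tsum_nonneg fun m => by positivity, fun m => ?_⟩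
  have := h.le_tsum m fun j _ => by positivity
  rwa [inv_pow, ← div_eq_mul_inv, div_le_iff₀ (by positivity)] at this

theorem summable_abs_pochhammerRatio_mul_pow_div_factorial {n : ℝ}
    (hn : ∀ k : ℕ, 1 + 2 * n ≠ -(k : ℝ)) {r : ℝ} (hr : 0 ≤ r) :
    Summable fun m => |pochhammerRatio n m| * (r ^ m / (m.factorial : ℝ)) := by
  obtain ⟨C, -, hC⟩ := exists_abs_pochhammerRatio_le hn one_lt_two
  refine .of_nonneg_of_le (fun m => by positivity) (fun m => ?_)
    ((Real.summable_pow_div_factorial (2 * r)).mul_left C)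
  rw [mul_pow, mul_div_assoc, ← mul_assoc]
  exact mul_le_mul_of_nonneg_right (hC m) (by positivity)

/-! ### Kummer's second transformation -/

/-- The coefficients of `₀F₁(; n + 1; y²/4)` as a power series in `y²`. -/
noncomputable def besselCoeff (n : ℝ) (k : ℕ) : ℝ :=
  1 / (4 ^ k * (k.factorial : ℝ) * (ascPochhammer ℝ k).eval (n + 1))

theorem besselCoeff_succ {n : ℝ} (hn : ∀ k : ℕ, n + 1 ≠ -(k : ℝ)) (k : ℕ) :
    besselCoeff n (k + 1) * (4 * (k + 1) * (n + 1 + k)) = besselCoeff n k := by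
  have h1 := ascPochhammer_eval_ne_zero hn k
  have h2 := add_natCast_ne_zero hn k
  have h3 : (k.factorial : ℝ) ≠ 0 := by positivity
  have h4 : (k : ℝ) + 1 ≠ 0 := by positivity
  rw [besselCoeff, besselCoeff, ascPochhammer_succ_eval, Nat.factorial_succ, pow_succ]
  push_cast
  field_simp

/-- The power series `₀F₁(; n + 1; X²/4)`. -/
noncomputable def besselPowerSeries (n : ℝ) : PowerSeries ℝ :=
  PowerSeries.mk fun i => if Even i then besselCoeff n (i / 2) else 0

theorem coeff_besselPowerSeries_even (n : ℝ) (k : ℕ) :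
    PowerSeries.coeff (2 * k) (besselPowerSeries n) = besselCoeff n k := by
  simp [besselPowerSeries]

theorem coeff_besselPowerSeries_odd (n : ℝ) (k : ℕ) :
    PowerSeries.coeff (2 * k + 1) (besselPowerSeries n) = 0 := by
  simp [besselPowerSeries]

open PowerSeries in
-- The modified Bessel equation rewritten for `y^{-n} I_n(y)`; on coefficients it is the recursion
-- `besselCoeff_succ`.
theorem besselPowerSeries_ode {n : ℝ} (hn : ∀ k : ℕ, n + 1 ≠ -(k : ℝ)) :
    X * d⁄dX ℝ (d⁄dX ℝ (besselPowerSeries n)) + C (1 + 2 * n) * d⁄dX ℝ (besselPowerSeries n) =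
      X * besselPowerSeries n := by
  ext i
  cases i with
  | zero =>
    have := coeff_besselPowerSeries_odd n 0
    simp only [mul_zero, zero_add] at this
    rw [map_add, coeff_zero_X_mul, coeff_zero_X_mul, coeff_C_mul, coeff_derivative, zero_add,
      zero_add, this]
    ring
  | succ i =>
    rw [map_add, coeff_succ_X_mul, coeff_succ_X_mul, coeff_C_mul, coeff_derivative,
      coeff_derivative]
    obtain ⟨k, rfl | rfl⟩ := Nat.even_or_odd' i
    · have h := besselCoeff_succ hn k
      rw [show 2 * k + 1 + 1 = 2 * (k + 1) by ring, coeff_besselPowerSeries_even,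
        coeff_besselPowerSeries_even, ← h]
      push_cast
      ring
    · rw [show 2 * k + 1 + 1 + 1 = 2 * (k + 1) + 1 by ring, coeff_besselPowerSeries_odd,
        coeff_besselPowerSeries_odd]
      ring

open PowerSeries in
/-- Kummer's second transformation, at the level of coefficients. -/
theorem coeff_exp_mul_besselPowerSeries {n : ℝ} (hn : ∀ k : ℕ, 1 + 2 * n ≠ -(k : ℝ)) (m : ℕ) :
    coeff m (exp ℝ * besselPowerSeries n) =
      pochhammerRatio n m * (2 ^ m / (m.factorial : ℝ)) := by
  set g := besselPowerSeries n with hg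
  set h := exp ℝ * g with hh
  have hode := besselPowerSeries_ode (add_one_ne_neg_natCast hn)
  have d1 : d⁄dX ℝ h = h + exp ℝ * d⁄dX ℝ g := by
    rw [hh, Derivation.leibniz, derivative_exp]
    simp only [smul_eq_mul]
    ring
  have d2 : d⁄dX ℝ (d⁄dX ℝ h) = h + 2 * (exp ℝ * d⁄dX ℝ g) + exp ℝ * d⁄dX ℝ (d⁄dX ℝ g) := by
    rw [d1, map_add, d1, Derivation.leibniz, derivative_exp]
    simp only [smul_eq_mul]
    ring
  -- Kummer's equation in the variable `2X`, with parameters `n + 1/2` and `1 + 2n`. Its recursion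
  -- on coefficients is two-term, so the constant term determines `h`.
  have ode : X * d⁄dX ℝ (d⁄dX ℝ h) + C (1 + 2 * n) * d⁄dX ℝ h =
      C 2 * (X * d⁄dX ℝ h) + C (1 + 2 * n) * h := by
    have c2 : (C (2 : ℝ) : PowerSeries ℝ) = 2 := map_ofNat _ 2
    rw [d2, d1, c2]
    linear_combination exp ℝ * hode - (X : PowerSeries ℝ) * hh
  have hrec : ∀ m : ℕ, coeff (m + 1) h * ((m + 1) * (1 + 2 * n + m)) =
      coeff m h * (2 * (n + 1 / 2 + m)) := by
    intro m
    have := congrArg (coeff m) ode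
    cases m with
    | zero =>
      simp only [LinearMap.map_add, coeff_C_mul, coeff_zero_X_mul, coeff_derivative] at this
      push_cast at this ⊢
      linear_combination this
    | succ m =>
      simp only [LinearMap.map_add, coeff_C_mul, coeff_succ_X_mul, coeff_derivative] at this
      push_cast at this ⊢
      linear_combination this
  induction m with
  | zero =>
    have h0 := coeff_besselPowerSeries_even n 0
    rw [mul_zero] at h0
    rw [hh, hg, coeff_mul, Finset.Nat.antidiagonal_zero, Finset.sum_singleton, h0]
    simp [besselCoeff, pochhammerRatio]
  | succ m ih =>
    have h1 := add_natCast_ne_zero hn m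
    have h2 : (m : ℝ) + 1 ≠ 0 := by positivity
    have h3 : (m.factorial : ℝ) ≠ 0 := by positivity
    have h4 := pochhammerRatio_succ hn m
    refine mul_right_cancel₀ (mul_ne_zero h2 h1) ?_
    rw [hrec m, ih, Nat.factorial_succ]
    push_cast
    field_simp
    linear_combination (-(2 : ℝ) ^ (m + 1)) * h4

theorem summable_norm_besselCoeff_mul_pow {n : ℝ} (hn : ∀ k : ℕ, n + 1 ≠ -(k : ℝ)) (y : ℝ) :
    Summable fun k => ‖besselCoeff n k * y ^ (2 * k)‖ := by
  suffices h : Summable fun k => besselCoeff n k * y ^ (2 * k) from h.norm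
  refine summable_of_ratio_norm_eventually_le (r := 1 / 4) (by norm_num) ?_
  -- Beyond this threshold `n + 1 + k ≥ 1` and `y² ≤ k + 1`, which gives ratio at most `1/4`.
  filter_upwards [eventually_ge_atTop ⌈y ^ 2 + |n|⌉₊] with k hk
  have hk' : y ^ 2 + |n| ≤ k := Nat.ceil_le.1 hk
  have h1 : 1 ≤ n + 1 + k := by nlinarith [neg_abs_le n, sq_nonneg y]
  have h2 : y ^ 2 ≤ k + 1 := by linarith [abs_nonneg n]
  have h3 : y ^ 2 ≤ ((k : ℝ) + 1) * (n + 1 + k) :=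
    h2.trans (le_mul_of_one_le_right (by positivity) h1)
  have h4 : ‖besselCoeff n k‖ = ‖besselCoeff n (k + 1)‖ * (4 * (k + 1) * (n + 1 + k)) := by
    rw [← besselCoeff_succ hn k, norm_mul]
    congr 1
    exact Real.norm_of_nonneg (by positivity)
  have h5 : ‖y ^ (2 * (k + 1))‖ = ‖y ^ (2 * k)‖ * y ^ 2 := by
    rw [mul_add, pow_add, norm_mul, mul_one, Real.norm_of_nonneg (sq_nonneg y)]
  rw [norm_mul, norm_mul, h4, h5]
  calc _ = ‖besselCoeff n (k + 1)‖ * ‖y ^ (2 * k)‖ * y ^ 2 := by ring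
    _ ≤ ‖besselCoeff n (k + 1)‖ * ‖y ^ (2 * k)‖ * (((k : ℝ) + 1) * (n + 1 + k)) :=
      mul_le_mul_of_nonneg_left h3 (by positivity)
    _ = _ := by ring

theorem hasSum_besselPowerSeries {n : ℝ} (hn : ∀ k : ℕ, n + 1 ≠ -(k : ℝ)) (y : ℝ) :
    (Summable fun i => ‖PowerSeries.coeff i (besselPowerSeries n) * y ^ i‖) ∧
    HasSum (fun i => PowerSeries.coeff i (besselPowerSeries n) * y ^ i)
      (∑' k, besselCoeff n k * y ^ (2 * k)) := by
  have hs := summable_norm_besselCoeff_mul_pow hn y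
  constructor
  · refine (HasSum.even_add_odd (m := ∑' k, ‖besselCoeff n k * y ^ (2 * k)‖) (m' := 0)
      ?_ ?_).summable
    · simpa only [coeff_besselPowerSeries_even] using hs.hasSum
    · simpa only [coeff_besselPowerSeries_odd, zero_mul, norm_zero] using hasSum_zero
  · rw [← add_zero (∑' k, besselCoeff n k * y ^ (2 * k))]
    refine HasSum.even_add_odd ?_ ?_
    · simpa only [coeff_besselPowerSeries_even] using hs.of_norm.hasSum
    · simpa only [coeff_besselPowerSeries_odd, zero_mul] using hasSum_zero

/-- The function `₁F₁(n + 1/2; 1 + 2n; 2y)`. -/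
noncomputable def kummerSeries (n y : ℝ) : ℝ :=
  ∑' m : ℕ, pochhammerRatio n m * (2 ^ m / (m.factorial : ℝ)) * y ^ m

theorem exp_mul_tsum_besselCoeff {n : ℝ} (hn : ∀ k : ℕ, 1 + 2 * n ≠ -(k : ℝ)) (y : ℝ) :
    Real.exp y * ∑' k, besselCoeff n k * y ^ (2 * k) = kummerSeries n y := by
  obtain ⟨h1, h2⟩ := hasSum_besselPowerSeries (add_one_ne_neg_natCast hn) y
  have h3 : Summable fun i : ℕ => ‖y ^ i / (i.factorial : ℝ)‖ :=
    (Real.summable_pow_div_factorial y).norm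
  rw [← h2.tsum_eq, Real.exp_eq_exp_ℝ, NormedSpace.exp_eq_tsum_div,
    tsum_mul_tsum_eq_tsum_sum_antidiagonal_of_summable_norm h3 h1, kummerSeries]
  refine tsum_congr fun m => ?_
  rw [← coeff_exp_mul_besselPowerSeries hn, PowerSeries.coeff_mul, Finset.sum_mul]
  refine Finset.sum_congr rfl fun p hp => ?_
  rw [← Finset.HasAntidiagonal.mem_antidiagonal.1 hp, PowerSeries.coeff_exp, pow_add]
  simp only [one_div, map_inv₀, map_natCast]
  ring

theorem continuous_kummerSeries {n : ℝ} (hn : ∀ k : ℕ, 1 + 2 * n ≠ -(k : ℝ)) :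
    Continuous (kummerSeries n) := by
  refine continuous_tsum_mul_pow fun r hr => ?_
  refine (summable_abs_pochhammerRatio_mul_pow_div_factorial hn
    (mul_nonneg zero_le_two hr)).congr fun m => ?_
  rw [abs_mul, abs_of_nonneg (a := (2 : ℝ) ^ m / _) (by positivity), mul_pow]
  ring

theorem Gamma_add_natCast_add_one {n : ℝ} (hn : ∀ k : ℕ, n + 1 ≠ -(k : ℝ)) (k : ℕ) :
    Real.Gamma (n + k + 1) = Real.Gamma (n + 1) * (ascPochhammer ℝ k).eval (n + 1) := by
  induction k with
  | zero => simp
  | succ k ih =>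
    have h := add_natCast_ne_zero hn k
    rw [show n + ((k + 1 : ℕ) : ℝ) + 1 = n + k + 1 + 1 by push_cast; ring,
      Real.Gamma_add_one (by rwa [add_right_comm]), ih, ascPochhammer_succ_eval]
    ring

/-- The factors `y^{-n}` and `y^n` cancel for `y > 0`, leaving a function continuous at `0`; hence
integrability whatever the sign of `n`. -/
theorem lipschitzHankelIntegrand_neg_eq {n : ℝ} (hn : ∀ k : ℕ, 1 + 2 * n ≠ -(k : ℝ)) (a : ℝ)
    {y : ℝ} (hy : 0 < y) :
    lipschitzHankelIntegrand (-n) n a y =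
      1 / (2 ^ n * Real.Gamma (n + 1)) * (Real.exp (-((1 + a) * y)) * kummerSeries n y) := by
  have hn' := add_one_ne_neg_natCast hn
  have hG := Real.Gamma_ne_zero hn'
  have hb : besselI n y =
      (y / 2) ^ n * (1 / Real.Gamma (n + 1) * ∑' k, besselCoeff n k * y ^ (2 * k)) := by
    rw [besselI]
    congr 1
    rw [← tsum_mul_left]
    refine tsum_congr fun k => ?_
    have := ascPochhammer_eval_ne_zero hn' k
    rw [Gamma_add_natCast_add_one hn', besselCoeff, div_pow, pow_mul 2]
    norm_num
    field_simp
  -- Frees the factor `e^y` that Kummer's transformation consumes.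
  have he : Real.exp (-(a * y)) = Real.exp (-((1 + a) * y)) * Real.exp y := by
    rw [← Real.exp_add]; congr 1; ring
  have h2 : (2 : ℝ) ^ n ≠ 0 := (Real.rpow_pos_of_pos two_pos n).ne'
  have hyn : y ^ n ≠ 0 := (Real.rpow_pos_of_pos hy n).ne'
  rw [lipschitzHankelIntegrand, hb, he, ← exp_mul_tsum_besselCoeff hn, Real.rpow_neg hy.le,
    Real.div_rpow hy.le zero_le_two]
  field_simp

theorem intervalIntegrable_lipschitzHankelIntegrand {n : ℝ} (hn : ∀ k : ℕ, 1 + 2 * n ≠ -(k : ℝ))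
    (a : ℝ) {x : ℝ} (hx : 0 ≤ x) :
    IntervalIntegrable (lipschitzHankelIntegrand (-n) n a) volume 0 x := by
  have hc : Continuous fun y =>
      1 / (2 ^ n * Real.Gamma (n + 1)) * (Real.exp (-((1 + a) * y)) * kummerSeries n y) := by
    have := continuous_kummerSeries hn
    fun_prop
  refine (hc.intervalIntegrable 0 x).congr fun y hy => ?_
  rw [uIoc_of_le hx] at hy
  exact (lipschitzHankelIntegrand_neg_eq hn a hy.1).symm

/-! ### Termwise integration -/

theorem integral_pow_mul_exp_neg_mul {s : ℝ} (hs : s ≠ 0) (x : ℝ) (m : ℕ) :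
    ∫ y in (0 : ℝ)..x, Real.exp (-(s * y)) * (y ^ m / (m.factorial : ℝ)) =
      1 / s ^ (m + 1) * (1 - Real.exp (-(s * x)) * expSum m (s * x)) := by
  have hd : ∀ y : ℝ, HasDerivAt
      (fun y => -(1 / s ^ (m + 1)) * (Real.exp (-(s * y)) * expSum m (s * y)))
      (Real.exp (-(s * y)) * (y ^ m / (m.factorial : ℝ))) y := fun y => by
    have hl : HasDerivAt (fun y => s * y) s y := by
      simpa using (hasDerivAt_id y).const_mul s
    refine (((hasDerivAt_exp_neg_mul_expSum m (s * y)).comp y hl).const_mul _).congr_deriv ?_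
    rw [mul_pow, pow_succ]
    field_simp
  rw [intervalIntegral.integral_eq_sub_of_hasDerivAt (fun y _ => hd y)
    (Continuous.intervalIntegrable (by fun_prop) _ _)]
  simp only [mul_zero, neg_zero, Real.exp_zero, expSum_zero_right]
  ring

theorem hasSum_integral_exp_neg_mul_kummerSeries {n : ℝ} (hn : ∀ k : ℕ, 1 + 2 * n ≠ -(k : ℝ))
    {s x : ℝ} (hs : 0 < s) (hx : 0 ≤ x) :
    HasSum (fun m => 1 / s * (pochhammerRatio n m * (2 / s) ^ m) -
        1 / s * Real.exp (-(s * x)) * (pochhammerRatio n m * (2 / s) ^ m * expSum m (s * x)))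
      (∫ y in (0 : ℝ)..x, Real.exp (-(s * y)) * kummerSeries n y) := by
  have hsum : ∀ r : ℝ, 0 ≤ r →
      Summable fun m => |pochhammerRatio n m| * (2 ^ m / (m.factorial : ℝ)) * r ^ m :=
    fun r hr => (summable_abs_pochhammerRatio_mul_pow_div_factorial hn
      (mul_nonneg zero_le_two hr)).congr fun m => by rw [mul_pow]; ring
  have key : HasSum (fun m => ∫ y in (0 : ℝ)..x, pochhammerRatio n m * 2 ^ m *
      (Real.exp (-(s * y)) * (y ^ m / (m.factorial : ℝ))))
      (∫ y in (0 : ℝ)..x, Real.exp (-(s * y)) * kummerSeries n y) := by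
    refine intervalIntegral.hasSum_integral_of_dominated_convergence
      -- From `e^{-sy} ≤ 1` and `y ≤ x`; the `m!` makes it summable for every `x`.
      (fun m _ => |pochhammerRatio n m| * (2 ^ m / (m.factorial : ℝ)) * x ^ m)
      (fun m => Continuous.aestronglyMeasurable (by fun_prop)) (fun m => ?_) ?_ ?_ ?_
    · refine ae_of_all _ fun y hy => ?_
      rw [uIoc_of_le hx] at hy
      have h0 := hy.1.le
      have he : Real.exp (-(s * y)) ≤ 1 := Real.exp_le_one_iff.2 (by nlinarith)
      have hp : y ^ m ≤ x ^ m := pow_le_pow_left₀ h0 hy.2 m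
      rw [norm_mul, norm_mul, Real.norm_eq_abs, Real.norm_of_nonneg (r := (2 : ℝ) ^ m) (by positivity),
        Real.norm_of_nonneg (by positivity)]
      calc _ ≤ |pochhammerRatio n m| * 2 ^ m * (1 * (x ^ m / (m.factorial : ℝ))) := by gcongr
        _ = _ := by ring
    · exact ae_of_all _ fun _ _ => hsum x hx
    · exact intervalIntegrable_const
    · refine ae_of_all _ fun y hy => ?_
      rw [uIoc_of_le hx] at hy
      have : Summable fun m => pochhammerRatio n m * (2 ^ m / (m.factorial : ℝ)) * y ^ m := by
        refine .of_norm ((hsum y hy.1.le).congr fun m => ?_)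
        rw [norm_mul, norm_mul, Real.norm_eq_abs, Real.norm_of_nonneg (by positivity),
          Real.norm_of_nonneg (pow_nonneg hy.1.le m)]
      exact (this.hasSum.mul_left (Real.exp (-(s * y)))).congr_fun fun m => by ring
  refine key.congr_fun fun m => ?_
  rw [intervalIntegral.integral_const_mul, integral_pow_mul_exp_neg_mul hs.ne', div_pow, pow_succ]
  field_simp

/-! ### The Humbert series and the general formula -/

theorem humbertPhi1Term_one (n u v : ℝ) (p : ℕ × ℕ) :
    humbertPhi1Term (n + 1 / 2) 1 (1 + 2 * n) u v p =
      pochhammerRatio n (p.1 + p.2) * (u ^ p.1 * (v ^ p.2 / (p.2.factorial : ℝ))) := by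
  have h : (p.1.factorial : ℝ) ≠ 0 := by positivity
  rw [humbertPhi1Term, ascPochhammer_eval_one, pochhammerRatio]
  field_simp

theorem summable_humbertPhi1Term_one {n u : ℝ} (hn : ∀ k : ℕ, 1 + 2 * n ≠ -(k : ℝ)) (hu : |u| < 1)
    (v : ℝ) : Summable (humbertPhi1Term (n + 1 / 2) 1 (1 + 2 * n) u v) := by
  have hpos : 0 < 1 + |u| := by positivity
  -- Chosen so that `ρ > 1` and `ρ|u| < 1`: the majorant is a geometric series times an exponential
  -- one.
  set ρ := 2 / (1 + |u|) with hρ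
  have h0 : 0 ≤ ρ := by positivity
  have h1 : 1 < ρ := by rw [hρ, one_lt_div hpos]; linarith
  have h2 : ρ * |u| < 1 := by rw [hρ, div_mul_eq_mul_div, div_lt_one hpos]; linarith
  obtain ⟨C, hC0, hC⟩ := exists_abs_pochhammerRatio_le hn h1
  refine .of_norm_bounded (((summable_geometric_of_lt_one (by positivity) h2).mul_of_nonneg
    (Real.summable_pow_div_factorial (ρ * |v|)) (fun k => by positivity)
    (fun k => by positivity)).mul_left C) fun p => ?_
  rw [humbertPhi1Term_one, norm_mul, norm_mul, norm_div, norm_pow, norm_pow, Real.norm_eq_abs,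
    Real.norm_eq_abs, Real.norm_eq_abs, RCLike.norm_natCast]
  calc _ ≤ C * ρ ^ (p.1 + p.2) * (|u| ^ p.1 * (|v| ^ p.2 / (p.2.factorial : ℝ))) := by
        gcongr; exact hC _
    _ = _ := by rw [pow_add, mul_pow, mul_pow]; ring

/-- With `v = uw`, every term with `j + k = m` carries `u^m` and the same Pochhammer ratio, so the
antidiagonal sums to a truncated exponential in `w`. -/
theorem hasSum_humbertPhi1_one {n u : ℝ} (hn : ∀ k : ℕ, 1 + 2 * n ≠ -(k : ℝ)) (hu : |u| < 1)
    (w : ℝ) : HasSum (fun m => pochhammerRatio n m * u ^ m * expSum m w)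
      (humbertPhi1 (n + 1 / 2) 1 (1 + 2 * n) u (u * w)) := by
  have h := (summable_humbertPhi1Term_one hn hu (u * w)).hasSum
  rw [← Finset.HasAntidiagonal.sigmaAntidiagonalEquivProd.hasSum_iff] at h
  refine (h.sigma fun m => hasSum_fintype _).congr_fun fun m => ?_
  have e : ∀ p ∈ Finset.HasAntidiagonal.antidiagonal m,
      humbertPhi1Term (n + 1 / 2) 1 (1 + 2 * n) u (u * w) p =
        pochhammerRatio n m * u ^ m * (w ^ p.2 / (p.2.factorial : ℝ)) := fun p hp => by
    rw [humbertPhi1Term_one, Finset.HasAntidiagonal.mem_antidiagonal.1 hp,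
      ← Finset.HasAntidiagonal.mem_antidiagonal.1 hp, pow_add, mul_pow]
    ring
  refine Eq.trans ?_ (Finset.sum_coe_sort (Finset.HasAntidiagonal.antidiagonal m)
    (humbertPhi1Term (n + 1 / 2) 1 (1 + 2 * n) u (u * w))).symm
  rw [Finset.sum_congr rfl e, ← Finset.mul_sum, expSum, ← Finset.Nat.sum_antidiagonal_swap,
    Finset.Nat.sum_antidiagonal_eq_sum_range_succ_mk]
  rfl

theorem lipschitzHankelIe_neg_eq {n : ℝ} (hn : ∀ k : ℕ, 1 + 2 * n ≠ -(k : ℝ)) {a x : ℝ}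
    (ha : 1 < a) (hx : 0 < x) :
    lipschitzHankelIe (-n) n x a =
      ordinaryHypergeometric (n + 1 / 2) 1 (1 + 2 * n) (2 / (1 + a)) /
          ((1 + a) * Real.Gamma (n + 1) * (2 : ℝ) ^ n) -
        humbertPhi1 (n + 1 / 2) 1 (1 + 2 * n) (2 / (1 + a)) (2 * x) /
          ((2 : ℝ) ^ n * (1 + a) * Real.Gamma (n + 1) * Real.exp (x * (1 + a))) := by
  have hs : 0 < 1 + a := by linarith
  have hu0 : 0 ≤ 2 / (1 + a) := by positivity
  have hu : 2 / (1 + a) < 1 := by rw [div_lt_one hs]; linarith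
  have h1 : HasSum (fun m => pochhammerRatio n m * (2 / (1 + a)) ^ m)
      (ordinaryHypergeometric (n + 1 / 2) 1 (1 + 2 * n) (2 / (1 + a))) := by
    rw [ordinaryHypergeometric_one_eq_tsum]
    refine (Summable.of_norm ((summable_abs_pochhammerRatio_mul_pow hn hu0 hu).congr
      fun m => ?_)).hasSum
    rw [norm_mul, Real.norm_eq_abs, Real.norm_of_nonneg (pow_nonneg hu0 m)]
  have h2 := hasSum_humbertPhi1_one hn (by rwa [abs_of_nonneg hu0]) ((1 + a) * x)
  rw [show 2 / (1 + a) * ((1 + a) * x) = 2 * x by field_simp] at h2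
  have hI : lipschitzHankelIe (-n) n x a = 1 / (2 ^ n * Real.Gamma (n + 1)) *
      ∫ y in (0 : ℝ)..x, Real.exp (-((1 + a) * y)) * kummerSeries n y := by
    rw [lipschitzHankelIe, ← intervalIntegral.integral_const_mul]
    -- The endpoint `0`, where the power cancellation may fail, lies outside the half-open interval.
    refine intervalIntegral.integral_congr_ae (ae_of_all _ fun y hy => ?_)
    rw [uIoc_of_le hx.le] at hy
    exact lipschitzHankelIntegrand_neg_eq hn a hy.1
  rw [hI, (hasSum_integral_exp_neg_mul_kummerSeries hn hs hx.le).unique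
    ((h1.mul_left _).sub (h2.mul_left _)), Real.exp_neg, mul_comm x (1 + a)]
  have hG := Real.Gamma_ne_zero (add_one_ne_neg_natCast hn)
  have h2n : (2 : ℝ) ^ n ≠ 0 := (Real.rpow_pos_of_pos two_pos n).ne'
  field_simp

theorem theorem9 (a x : ℝ) (ha : 1 < a) (hx : 0 < x) :
    (∀ n : ℝ, (∀ k : ℕ, 1 + 2 * n ≠ -(k : ℝ)) →
      IntervalIntegrable (lipschitzHankelIntegrand (-n) n a) volume 0 x ∧
      Summable (humbertPhi1Term (n + 1 / 2) 1 (1 + 2 * n) (2 / (1 + a)) (2 * x)) ∧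
      lipschitzHankelIe (-n) n x a =
        ordinaryHypergeometric (n + 1 / 2) 1 (1 + 2 * n) (2 / (1 + a)) /
            ((1 + a) * Real.Gamma (n + 1) * (2 : ℝ) ^ n) -
          humbertPhi1 (n + 1 / 2) 1 (1 + 2 * n) (2 / (1 + a)) (2 * x) /
            ((2 : ℝ) ^ n * (1 + a) * Real.Gamma (n + 1) * Real.exp (x * (1 + a)))) ∧
    (∀ b c : ℝ,
      b = √x * √(a + √((a + 1) * (a - 1))) →
      c = √x * √(a - √((a + 1) * (a - 1))) →
      IntegrableOn (marcumQIntegrand b) (Set.Ioi c) ∧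
      IntegrableOn (marcumQIntegrand c) (Set.Ioi b) ∧
      lipschitzHankelIe 0 0 x a =
        (marcumQ b c - marcumQ c b) / √((a + 1) * (a - 1))) := by
  refine ⟨fun n hn => ⟨intervalIntegrable_lipschitzHankelIntegrand hn a hx.le,
    summable_humbertPhi1Term_one hn ?_ _, lipschitzHankelIe_neg_eq hn ha hx⟩,
    fun b c hb hc => lipschitzHankelIe_zero_zero a x b c ha hx hb hc⟩
  rw [abs_of_pos (by positivity), div_lt_one (by linarith)]
  linarith
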